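/- Let $K$ be a field, $n\ge 0$, and let $S=K[x_1,\dots,x_n]$ be the standard graded polynomial ring. Let $d\in\mathbb Z$ and let $$\mathbb G:\ \cdots\to G_2\to G_1\to G_0\to 0$$ be a nonzero finite linear complex with initial degree $d$, that is, a graded complex (with differentials homogeneous of degree $0$) of free $S$-modules such that $G_i= S(-i-d)^{b_i}$ with integers $b_i\ge 0$ for all $i$, and $b_i=0$ for $i\gg 0$. For a finitely generated ($\mathbb Z$-)graded $S$-module $M$ with initial degree $d$ (that is, $d$ is the smallest integer $j$ with $M_j\neq 0$) and minimal graded free resolution $\mathbb F$ of $M$, with $F_i=\bigoplus_j S(-j)^{\beta_{i,j}}$, let $F_i^{\rm lin}$ be the direct summand $S(-i-d)^{\beta_{i,i+d}}$ of $F_i$. The subcomplex $\mathbb F^{\rm lin}:\ \cdots\to F_1^{\rm lin}\to F_0^{\rm lin}\to 0$ of $\mathbb F$ is called the linear strand of (the resolution of) $M$. The following conditions are equivalent: (a) $\mathbb G$ is isomorphic, as a graded complex, to the linear strand of a finitely generated graded $S$-module with initial degree $d$. (b) $H_i(\mathbb G)_{i+d+j}=0$ for all $i>0$ and for $j=0,1$.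 -/

import Mathlib

namespace LinearStrands

universe u

/-- The standard graded polynomial ring `S = K[x₁, …, xₙ]`. -/
abbrev Poly (K : Type u) [Field K] (n : ℕ) : Type u := MvPolynomial (Fin n) K

variable (K : Type u) [Field K] (n : ℕ)

/-- The component `S_j` of `S`, for every integer `j`; it is zero for `j < 0`. -/
noncomputable def polyPiece : ℤ → Submodule K (Poly K n)
  | Int.ofNat a => MvPolynomial.homogeneousSubmodule (Fin n) K a
  | Int.negSucc _ => ⊥

/-- The graded maximal ideal `(x₁, …, xₙ)` of `S`. -/
noncomputable def irrelevantIdeal : Ideal (Poly K n) :=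
  Ideal.span (Set.range (MvPolynomial.X : Fin n → Poly K n))

/-- A `ℤ`-graded `S`-module: `M = ⨁ M_j` as an abelian group, with `S_i M_j ⊆ M_{i+j}`. -/
structure GrMod where
  carrier : Type u
  [addCommGroup : AddCommGroup carrier]
  [module : Module (Poly K n) carrier]
  piece : ℤ → AddSubgroup carrier
  isInternal : DirectSum.IsInternal piece
  gradedSMul : SetLike.GradedSMul (polyPiece K n) piece

attribute [instance] GrMod.addCommGroup GrMod.module

/-- `d` is the initial degree of `M`: the smallest integer `j` with `M_j ≠ 0`. -/
def GrMod.HasInitialDegree {K : Type u} [Field K] {n : ℕ} (M : GrMod K n) (d : ℤ) : Prop :=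
  IsLeast {j : ℤ | M.piece j ≠ ⊥} d

/-- The component of degree `j` of the graded free module `S(-a₁) ⊕ ⋯ ⊕ S(-a_r)`,
where `S(-a)_j = S_{j-a}`. -/
noncomputable def freePiece {r : ℕ} (a : Fin r → ℤ) (j : ℤ) : AddSubgroup (Fin r → Poly K n) where
  carrier := {x | ∀ k, x k ∈ polyPiece K n (j - a k)}
  zero_mem' := fun _ => Submodule.zero_mem _
  add_mem' := fun hx hy k => Submodule.add_mem _ (hx k) (hy k)
  neg_mem' := fun hx k => Submodule.neg_mem _ (hx k)

/-- A graded complex `⋯ → C₂ → C₁ → C₀ → 0` of finitely generated graded free `S`-modules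
`C_i = ⨁_k S(-deg i k)`, with differentials homogeneous of degree `0`.
The differential `C_{i+1} → C_i` is `diff i`. -/
structure FreeComplex where
  rank : ℕ → ℕ
  deg : ∀ i, Fin (rank i) → ℤ
  diff : ∀ i, (Fin (rank (i + 1)) → Poly K n) →ₗ[Poly K n] (Fin (rank i) → Poly K n)
  diff_comp_diff : ∀ i, diff i ∘ₗ diff (i + 1) = 0
  diff_mem : ∀ i j, ∀ x ∈ freePiece K n (deg (i + 1)) j, diff i x ∈ freePiece K n (deg i) j

namespace FreeComplex

variable {K n}
variable (C : FreeComplex K n)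

/-- The free module in homological degree `i`. -/
abbrev X (i : ℕ) : Type u := Fin (C.rank i) → Poly K n

/-- The component of (internal) degree `j` of `C_i`. -/
noncomputable abbrev piece (i : ℕ) (j : ℤ) : AddSubgroup (C.X i) := freePiece K n (C.deg i) j

/-- The cycles in homological degree `i`. -/
noncomputable def cycles : ∀ i, Submodule (Poly K n) (C.X i)
  | 0 => ⊤
  | i + 1 => LinearMap.ker (C.diff i)

/-- The boundaries in homological degree `i`. -/
noncomputable def boundaries (i : ℕ) : Submodule (Poly K n) (C.X i) := LinearMap.range (C.diff i)

/-- The homology module `H_i(C)`, cycles modulo boundaries. -/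
abbrev Homology (i : ℕ) : Type u :=
  C.cycles i ⧸ (C.boundaries i).submoduleOf (C.cycles i)

/-- The graded component `H_i(C)_j`: the classes of the cycles of degree `j`. -/
noncomputable def homologyPiece (i : ℕ) (j : ℤ) : AddSubgroup (C.Homology i) :=
  ((C.piece i j).comap (C.cycles i).subtype.toAddMonoidHom).map
    ((C.boundaries i).submoduleOf (C.cycles i)).mkQ.toAddMonoidHom

/-- `C` is a linear complex with initial degree `d`: `C_i = S(-i-d)^{b_i}` for all `i`. -/
def IsLinear (d : ℤ) : Prop := ∀ i k, C.deg i k = i + d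

/-- `C` is finite: `C_i = 0` for all large `i`. -/
def IsFinite : Prop := ∃ N, ∀ i, N ≤ i → C.rank i = 0

/-- `C` is not the zero complex. -/
def IsNonzero : Prop := ∃ i, C.rank i ≠ 0

/-- `C`, augmented by a suitable map `C₀ → M`, is a minimal graded free resolution of `M`. -/
def IsMinimalResolution (M : GrMod K n) : Prop :=
  ∃ ε : C.X 0 →ₗ[Poly K n] M.carrier,
    (∀ j, ∀ x ∈ C.piece 0 j, ε x ∈ M.piece j) ∧
    Function.Surjective ε ∧
    LinearMap.range (C.diff 0) = LinearMap.ker ε ∧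
    (∀ i, LinearMap.range (C.diff (i + 1)) = LinearMap.ker (C.diff i)) ∧
    (∀ i, LinearMap.range (C.diff i) ≤ irrelevantIdeal K n • (⊤ : Submodule (Poly K n) (C.X i)))

/-- The direct summand `C_i^lin` of `C_i`: the sum of the summands `S(-i-d)` of `C_i`. -/
noncomputable def lin (d : ℤ) (i : ℕ) : Submodule (Poly K n) (C.X i) :=
  Submodule.span (Poly K n)
    {x | ∃ k, C.deg i k = i + d ∧ x = Pi.single k 1}

/-- `G` is isomorphic, as a graded complex, to the subcomplex `F^lin` of `F`.
(The last condition contains that the differential of `F` maps `F_{i+1}^lin` to `F_i^lin`.) -/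
def IsoLin (G F : FreeComplex K n) (d : ℤ) : Prop :=
  ∃ φ : ∀ i, G.X i ≃ₗ[Poly K n] F.lin d i,
    (∀ i j x, x ∈ G.piece i j ↔ (φ i x : F.X i) ∈ F.piece i j) ∧
    (∀ i x, (φ i (G.diff i x) : F.X i) = F.diff i (φ (i + 1) x : F.X (i + 1)))

end FreeComplex

end LinearStrands

/-! If `G` is the linear strand of a minimal resolution `F`, then `F_i` is generated in degrees at
least `i + d` (`IsMinimalResolution.le_deg`). A cycle of `G_i` of degree `i + d + j` bounds a
homogeneous `z` in `F_{i+1}` of that degree. This `z` is zero for `j = 0` and lies in the linear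
summand for `j = 1`, so the cycle already bounds in `G`.

Conversely, `H₀(G)` is resolved by modules `G_i ⊕ E_i`, with `E_i` generated in degrees above `i +
d`. The case `j = 0` makes `G_{i+1} → G_i` injective in the generator degree, so the generators of
`G` stay part of a minimal system. The case `j = 1` says that the kernel at stage `i > 0` has
nothing in degree `i + 1 + d` beyond the image of `G_{i+1}`, so no new linear generator is needed.
The inductive step is `ResolutionStage.exists_next`, which rests on `exists_minimal_generators`. -/

namespace LinearStrands

open MvPolynomial

/-! ### Graded pieces of polynomials and of free modules. -/

section Graded

variable {K : Type*} [Field K] {n : ℕ}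

theorem mem_polyPiece_iff {j : ℤ} {p : Poly K n} :
    p ∈ polyPiece K n j ↔ ∀ m, coeff m p ≠ 0 → (m.degree : ℤ) = j := by
  cases j with
  | ofNat a =>
    simp only [polyPiece, mem_homogeneousSubmodule, IsHomogeneous, IsWeightedHomogeneous,
      Finsupp.degree_eq_weight_one]
    simp [Pi.one_def]
  | negSucc a =>
    simp only [polyPiece, Submodule.mem_bot]
    constructor
    · rintro rfl m hm
      simp at hm
    · intro h
      ext m
      by_contra hm
      have := h m hm
      omega

theorem mul_mem_polyPiece {i j : ℤ} {p q : Poly K n} (hp : p ∈ polyPiece K n i)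
    (hq : q ∈ polyPiece K n j) : p * q ∈ polyPiece K n (i + j) := by
  classical
  rw [mem_polyPiece_iff] at *
  intro m hm
  rw [coeff_mul] at hm
  obtain ⟨⟨u, v⟩, huv, h⟩ := Finset.exists_ne_zero_of_sum_ne_zero hm
  rw [Finset.HasAntidiagonal.mem_antidiagonal] at huv
  have hu := hp u (left_ne_zero_of_mul h)
  have hv := hq v (right_ne_zero_of_mul h)
  simp only at huv
  rw [← huv, map_add]
  push_cast
  omega

theorem C_mem_polyPiece (c : K) : (C c : Poly K n) ∈ polyPiece K n 0 := by
  classical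
  rw [mem_polyPiece_iff]
  intro m hm
  rw [coeff_C] at hm
  have : 0 = m := by
    by_contra h
    simp [h] at hm
  simp [← this]

theorem eq_zero_of_mem_polyPiece {j : ℤ} (hj : j < 0) {p : Poly K n}
    (hp : p ∈ polyPiece K n j) : p = 0 := by
  rw [mem_polyPiece_iff] at hp
  ext m
  by_contra h
  have := hp m h
  omega

theorem constantCoeff_of_mem_polyPiece {j : ℤ} (hj : j ≠ 0) {p : Poly K n}
    (hp : p ∈ polyPiece K n j) : constantCoeff p = 0 := by
  rw [mem_polyPiece_iff] at hp
  by_contra h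
  exact hj (by simpa using (hp 0 h).symm)

theorem eq_C_of_mem_polyPiece_zero {p : Poly K n} (hp : p ∈ polyPiece K n 0) :
    p = C (constantCoeff p) := by
  classical
  rw [mem_polyPiece_iff] at hp
  ext m
  rw [coeff_C]
  split_ifs with h
  · rw [← h]; rfl
  · by_contra hm
    have := hp m hm
    exact h ((Finsupp.degree_eq_zero_iff m).mp (by exact_mod_cast this)).symm

/-- The homogeneous component of a polynomial in an integral degree. -/
noncomputable def intComponent (j : ℤ) : Poly K n →+ Poly K n :=
  if 0 ≤ j then (homogeneousComponent j.toNat).toAddMonoidHom else 0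

theorem coeff_intComponent (j : ℤ) (p : Poly K n) (m : Fin n →₀ ℕ) :
    coeff m (intComponent j p) = if (m.degree : ℤ) = j then coeff m p else 0 := by
  unfold intComponent
  split_ifs with h h' h'
  · simp only [LinearMap.toAddMonoidHom_coe, coeff_homogeneousComponent]
    rw [if_pos (by omega)]
  · simp only [LinearMap.toAddMonoidHom_coe, coeff_homogeneousComponent]
    rw [if_neg (by omega)]
  · omega
  · simp

theorem intComponent_mem (j : ℤ) (p : Poly K n) : intComponent j p ∈ polyPiece K n j := by
  rw [mem_polyPiece_iff]
  intro m hm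
  rw [coeff_intComponent] at hm
  by_contra h
  simp [h] at hm

theorem intComponent_of_mem {i : ℤ} {p : Poly K n} (hp : p ∈ polyPiece K n i) (j : ℤ) :
    intComponent j p = if i = j then p else 0 := by
  rw [mem_polyPiece_iff] at hp
  ext m
  rw [coeff_intComponent]
  by_cases h : coeff m p = 0
  · split_ifs <;> simp [h]
  · rw [hp m h]
    split_ifs <;> simp

theorem constantCoeff_intComponent_zero (p : Poly K n) :
    constantCoeff (intComponent 0 p) = constantCoeff p := by
  change coeff 0 (intComponent 0 p) = coeff 0 p
  simp [coeff_intComponent]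

theorem mem_irrelevantIdeal_iff {p : Poly K n} :
    p ∈ irrelevantIdeal K n ↔ constantCoeff p = 0 := by
  rw [irrelevantIdeal, ← Set.image_univ, mem_ideal_span_X_image]
  constructor
  · intro h
    by_contra hp
    obtain ⟨i, -, hi⟩ := h 0 (mem_support_iff.mpr hp)
    simp at hi
  · intro h m hm
    by_contra! hc
    have : m = 0 := by
      ext i
      simpa using hc i
    subst this
    exact (mem_support_iff.mp hm) h

/-- Minimality is tested from here on by constant terms of coordinates. -/
theorem mem_irrelevantIdeal_smul_top_iff {r : ℕ} {x : Fin r → Poly K n} :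
    x ∈ irrelevantIdeal K n • (⊤ : Submodule (Poly K n) (Fin r → Poly K n)) ↔
      ∀ k, constantCoeff (x k) = 0 := by
  constructor
  · intro h
    refine Submodule.smul_induction_on h (fun p hp y _ k => ?_) fun y z hy hz k => ?_
    · rw [mem_irrelevantIdeal_iff] at hp
      simp [hp]
    · simp [hy k, hz k]
  · intro h
    rw [pi_eq_sum_univ' x]
    exact Submodule.sum_mem _ fun k _ =>
      Submodule.smul_mem_smul (mem_irrelevantIdeal_iff.mpr (h k)) trivial

variable {r s : ℕ} (a : Fin r → ℤ) (b : Fin s → ℤ)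

theorem single_mem_freePiece (k : Fin r) :
    (Pi.single k 1 : Fin r → Poly K n) ∈ freePiece K n a (a k) := by
  intro l
  by_cases h : l = k
  · subst h
    simpa using C_mem_polyPiece (n := n) (1 : K)
  · simp [h]

theorem smul_mem_freePiece {i j : ℤ} {p : Poly K n} (hp : p ∈ polyPiece K n i)
    {x : Fin r → Poly K n} (hx : x ∈ freePiece K n a j) : p • x ∈ freePiece K n a (i + j) := by
  intro k
  have := mul_mem_polyPiece hp (hx k)
  rwa [← add_sub_assoc] at this

/-- The homogeneous component of degree `j` of an element of a graded free module. -/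
noncomputable def component (j : ℤ) : (Fin r → Poly K n) →+ (Fin r → Poly K n) where
  toFun x k := intComponent (j - a k) (x k)
  map_zero' := by ext1 k; simp
  map_add' x y := by ext1 k; simp

theorem component_apply (j : ℤ) (x : Fin r → Poly K n) (k : Fin r) :
    component a j x k = intComponent (j - a k) (x k) := rfl

theorem component_mem (j : ℤ) (x : Fin r → Poly K n) :
    component a j x ∈ freePiece K n a j := fun _ => intComponent_mem _ _

theorem component_of_mem {i : ℤ} {x : Fin r → Poly K n} (hx : x ∈ freePiece K n a i) (j : ℤ) :
    component a j x = if i = j then x else 0 := by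
  ext1 k
  rw [component_apply, intComponent_of_mem (hx k)]
  by_cases h : i = j
  · simp [h]
  · rw [if_neg h, if_neg (by omega)]
    rfl

theorem homogeneous_induction {P : (Fin r → Poly K n) → Prop}
    (hom : ∀ j, ∀ x ∈ freePiece K n a j, P x) (add : ∀ x y, P x → P y → P (x + y))
    (x : Fin r → Poly K n) : P x := by
  have zero : P 0 := hom 0 0 (AddSubgroup.zero_mem _)
  have key : ∀ k (p : Poly K n), P (Pi.single k p) := by
    intro k p
    induction p using MvPolynomial.induction_on' with
    | monomial m c =>
      refine hom (m.degree + a k) _ ?_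
      intro l
      by_cases h : l = k
      · subst h
        simp only [Pi.single_eq_same, add_sub_cancel_right]
        rw [mem_polyPiece_iff]
        intro m' hm'
        classical
        rw [coeff_monomial] at hm'
        have : m = m' := by
          by_contra h
          simp [h] at hm'
        rw [this]
      · simp [h]
    | add p q hp hq =>
      rw [Pi.single_add]
      exact add _ _ hp hq
  rw [← Finset.univ_sum_single x]
  exact Finset.sum_induction _ P add zero fun k _ => key k _

theorem exists_sum_component_eq (x : Fin r → Poly K n) :
    -- Allowing every larger `T'` lets the finite sets of two summands be merged by a union.
    ∃ T : Finset ℤ, ∀ T', T ⊆ T' → ∑ j ∈ T', component a j x = x := by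
  classical
  induction x using homogeneous_induction a with
  | hom j x hx =>
    refine ⟨{j}, fun T' hT' => ?_⟩
    simp only [component_of_mem a hx, Finset.sum_ite_eq]
    exact if_pos (hT' (Finset.mem_singleton_self j))
  | add x y hx hy =>
    obtain ⟨T, hT⟩ := hx
    obtain ⟨U, hU⟩ := hy
    refine ⟨T ∪ U, fun T' hT' => ?_⟩
    simp only [map_add, Finset.sum_add_distrib]
    rw [hT T' (Finset.union_subset_left hT'), hU T' (Finset.union_subset_right hT')]

variable {a b}

theorem component_map {f : (Fin r → Poly K n) →ₗ[Poly K n] (Fin s → Poly K n)}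
    (hf : ∀ j, ∀ x ∈ freePiece K n a j, f x ∈ freePiece K n b j) (j : ℤ) (x : Fin r → Poly K n) :
    component b j (f x) = f (component a j x) := by
  induction x using homogeneous_induction a with
  | hom i x hx =>
    rw [component_of_mem a hx, component_of_mem b (hf i x hx)]
    split_ifs <;> simp
  | add x y hx hy => simp [hx, hy]

/-- The matrix entries of `f` are homogeneous of degrees `a k - b l`, which are nonzero. -/
theorem constantCoeff_map_eq_zero {f : (Fin r → Poly K n) →ₗ[Poly K n] (Fin s → Poly K n)}
    (hf : ∀ j, ∀ x ∈ freePiece K n a j, f x ∈ freePiece K n b j) (h : ∀ k l, b l ≠ a k)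
    (x : Fin r → Poly K n) (l : Fin s) : constantCoeff (f x l) = 0 := by
  rw [pi_eq_sum_univ' x, map_sum, Finset.sum_apply, map_sum]
  refine Finset.sum_eq_zero fun k _ => ?_
  rw [map_smul, Pi.smul_apply, smul_eq_mul, map_mul]
  have h1 := hf _ _ (single_mem_freePiece (K := K) (n := n) a k) l
  have h2 := constantCoeff_of_mem_polyPiece (fun h' => h k l (by omega)) h1
  simp [h2]

end Graded

/-! ### Minimal homogeneous generators with a prescribed part in the lowest degree. -/

section Graded

variable {K : Type*} [Field K] {n r b : ℕ} {a : Fin r → ℤ} {a' : Fin b → ℤ}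

/-- Homogeneous generators of a graded submodule of a graded free module: the ones given by `g`
in degree `e` can be completed by generators of larger degrees to a minimal generating system. -/
theorem exists_minimal_generators (Z : Submodule (Poly K n) (Fin r → Poly K n))
    (hZ : ∀ x ∈ Z, ∀ j, component a j x ∈ Z) {e : ℤ} (ha' : ∀ k, a' k = e)
    (g : (Fin b → Poly K n) →ₗ[Poly K n] (Fin r → Poly K n))
    (hg : ∀ j, ∀ x ∈ freePiece K n a' j, g x ∈ freePiece K n a j) (hgZ : LinearMap.range g ≤ Z)
    (hlow : ∀ j < e, ∀ x ∈ Z, x ∈ freePiece K n a j → x = 0)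
    (he : ∀ x ∈ Z, x ∈ freePiece K n a e → x ∈ LinearMap.range g)
    (hinj : ∀ x ∈ freePiece K n a' e, g x = 0 → x = 0) :
    ∃ (c : ℕ) (cd : Fin c → ℤ)
      (f : (Fin (b + c) → Poly K n) →ₗ[Poly K n] (Fin r → Poly K n)),
      (∀ k, e < cd k) ∧
      (∀ j, ∀ x ∈ freePiece K n (Fin.append a' cd) j, f x ∈ freePiece K n a j) ∧
      LinearMap.range f = Z ∧ (∀ x, f (Fin.append x 0) = g x) ∧
      ∀ x, f x = 0 → ∀ k, constantCoeff (x k) = 0 := by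
  classical
  let P : ℕ → Prop := fun c => ∃ (cd : Fin c → ℤ) (h : Fin c → (Fin r → Poly K n)),
    (∀ k, e < cd k) ∧ (∀ k, h k ∈ freePiece K n a (cd k)) ∧
    LinearMap.range g ⊔ Submodule.span (Poly K n) (Set.range h) = Z
  have hP : ∃ c, P c := by
    let A : Set (Fin r → Poly K n) := {x | x ∈ Z ∧ ∃ j, e < j ∧ x ∈ freePiece K n a j}
    have hA : LinearMap.range g ⊔ Submodule.span (Poly K n) A = Z := by
      refine le_antisymm (sup_le hgZ (Submodule.span_le.mpr fun x hx => hx.1)) fun x hx => ?_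
      obtain ⟨T, hT⟩ := exists_sum_component_eq a x
      rw [← hT T subset_rfl]
      refine Submodule.sum_mem _ fun j _ => ?_
      rcases lt_trichotomy j e with hj | rfl | hj
      · rw [hlow j hj _ (hZ x hx j) (component_mem a j x)]
        exact Submodule.zero_mem _
      · exact Submodule.mem_sup_left (he _ (hZ x hx j) (component_mem a j x))
      · exact Submodule.mem_sup_right
          (Submodule.subset_span ⟨hZ x hx j, j, hj, component_mem a j x⟩)
    obtain ⟨B, hBA, hB⟩ := (Submodule.fg_span_iff_fg_span_finset_subset A).mp
      (IsNoetherian.noetherian (Submodule.span (Poly K n) A))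
    have hBdeg : ∀ k : Fin B.card, ∃ j, e < j ∧
        (B.equivFin.symm k : Fin r → Poly K n) ∈ freePiece K n a j :=
      fun k => (hBA (B.equivFin.symm k).2).2
    choose cd hcd hmem using hBdeg
    refine ⟨B.card, cd, fun k => B.equivFin.symm k, hcd, hmem, ?_⟩
    have : Set.range (fun k => (B.equivFin.symm k : Fin r → Poly K n)) = B := by
      ext x
      constructor
      · rintro ⟨k, rfl⟩
        exact (B.equivFin.symm k).2
      · intro hx
        exact ⟨B.equivFin ⟨x, hx⟩, by simp⟩
    rw [this, ← hB, hA]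
  -- The least possible number of extra generators is chosen, which forces minimality.
  obtain ⟨cd, h, hcd, hmem, hspan⟩ := Nat.find_spec hP
  have hmin := fun c => Nat.find_min hP (m := c)
  generalize Nat.find hP = c at cd h hcd hmem hspan hmin
  let f : (Fin (b + c) → Poly K n) →ₗ[Poly K n] (Fin r → Poly K n) :=
    g ∘ₗ LinearMap.funLeft _ _ (Fin.castAdd c) +
      Fintype.linearCombination (Poly K n) h ∘ₗ LinearMap.funLeft _ _ (Fin.natAdd b)
  have hf : ∀ x, f x = g (x ∘ Fin.castAdd c) + ∑ l, x (Fin.natAdd b l) • h l := fun x => rfl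
  have hfdeg : ∀ j, ∀ x ∈ freePiece K n (Fin.append a' cd) j, f x ∈ freePiece K n a j := by
    intro j x hx
    rw [hf]
    refine AddSubgroup.add_mem _ (hg j _ fun k => ?_) (AddSubgroup.sum_mem _ fun l _ => ?_)
    · simpa using hx (Fin.castAdd c k)
    · have h1 := hx (Fin.natAdd b l)
      rw [Fin.append_right] at h1
      simpa using smul_mem_freePiece a h1 (hmem l)
  have hfapp : ∀ x, f (Fin.append x 0) = g x := by
    intro x
    rw [hf]
    have : Fin.append x 0 ∘ Fin.castAdd c = x := by
      ext1 k
      simp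
    simp [this]
  refine ⟨c, cd, f, hcd, hfdeg, ?_, hfapp, ?_⟩
  · rw [← hspan]
    apply le_antisymm
    · rintro _ ⟨x, rfl⟩
      rw [hf]
      exact Submodule.add_mem_sup ⟨_, rfl⟩ (Submodule.sum_mem _ fun l _ =>
        Submodule.smul_mem _ _ (Submodule.subset_span ⟨l, rfl⟩))
    · refine sup_le ?_ (Submodule.span_le.mpr ?_)
      · rintro _ ⟨x, rfl⟩
        exact ⟨_, hfapp x⟩
      · rintro _ ⟨l, rfl⟩
        refine ⟨Pi.single (Fin.natAdd b l) 1, ?_⟩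
        rw [hf]
        have : (Pi.single (Fin.natAdd b l) 1 : Fin (b + c) → Poly K n) ∘ Fin.castAdd c = 0 := by
          ext1 k
          simp only [Function.comp_apply, Pi.zero_apply]
          exact Pi.single_eq_of_ne (by simp [Fin.ext_iff]; omega) _
        rw [this, map_zero, zero_add, Finset.sum_eq_single l]
        · simp
        · intro l' _ hl'
          rw [Pi.single_eq_of_ne (by simpa using hl'), zero_smul]
        · simp
  · intro x hx k
    induction k using Fin.addCases with
    | right l =>
      -- In degree `cd l`, the relation has a nonzero constant as coefficient of `h l`. Dividing by
      -- it expresses `h l` through the other generators, against the choice of `c`.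
      by_contra hne
      have hx' : f (component (Fin.append a' cd) (cd l) x) = 0 := by
        rw [← component_map hfdeg, hx, map_zero]
      rw [hf, ← Finset.add_sum_erase _ _ (Finset.mem_univ l)] at hx'
      have hl : component (Fin.append a' cd) (cd l) x (Fin.natAdd b l) =
          C (constantCoeff (x (Fin.natAdd b l))) := by
        rw [component_apply, Fin.append_right, sub_self, ← constantCoeff_intComponent_zero]
        exact eq_C_of_mem_polyPiece_zero (intComponent_mem _ _)
      rw [hl] at hx'
      obtain ⟨c, rfl⟩ : ∃ c', c = c' + 1 := ⟨c - 1, by have := l.pos; omega⟩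
      refine hmin c (by omega) ⟨cd ∘ l.succAbove, h ∘ l.succAbove, fun k => hcd _,
        fun k => hmem _, ?_⟩
      rw [← hspan]
      refine le_antisymm
        (sup_le_sup le_rfl (Submodule.span_mono (Set.range_comp_subset_range _ _)))
        (sup_le le_sup_left (Submodule.span_le.mpr ?_))
      rintro _ ⟨k, rfl⟩
      have hother : ∀ k, k ≠ l → h k ∈ LinearMap.range g ⊔
          Submodule.span (Poly K n) (Set.range (h ∘ l.succAbove)) := by
        intro k hk
        obtain ⟨k', rfl⟩ := Fin.exists_succAbove_eq hk
        exact Submodule.mem_sup_right (Submodule.subset_span ⟨k', rfl⟩)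
      by_cases hk : k = l
      · subst hk
        rw [add_left_comm, add_eq_zero_iff_eq_neg] at hx'
        have h1 : h k = (C (constantCoeff (x (Fin.natAdd b k)))⁻¹ : Poly K n) •
            ((C (constantCoeff (x (Fin.natAdd b k))) : Poly K n) • h k) := by
          rw [smul_smul, ← C_mul, inv_mul_cancel₀ hne, C_1, one_smul]
        rw [h1, hx']
        refine Submodule.smul_mem _ _ (Submodule.neg_mem _ (Submodule.add_mem _
          (Submodule.mem_sup_left ⟨_, rfl⟩) (Submodule.sum_mem _ fun k' hk' =>
            Submodule.smul_mem _ _ (hother k' (Finset.ne_of_mem_erase hk')))))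
      · exact hother k hk
    | left k =>
      -- In degree `e` the extra coordinates have negative degree and vanish, so the relation
      -- involves `g` alone and `hinj` applies.
      have hx' : f (component (Fin.append a' cd) e x) = 0 := by
        rw [← component_map hfdeg, hx, map_zero]
      rw [hf, Finset.sum_eq_zero, add_zero] at hx'
      · have := hinj _ (fun k => ?_) hx'
        · have hk := congrFun this k
          rw [Function.comp_apply, component_apply, Fin.append_left, ha', sub_self] at hk
          rw [← constantCoeff_intComponent_zero, hk]
          simp
        · have h1 := component_mem (Fin.append a' cd) e x (Fin.castAdd c k)
          rwa [Fin.append_left] at h1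
      · intro l _
        have h1 := component_mem (Fin.append a' cd) e x (Fin.natAdd b l)
        rw [Fin.append_right] at h1
        rw [eq_zero_of_mem_polyPiece (by have := hcd l; omega) h1, zero_smul]

end Graded

/-! ### Quotients of graded free modules. -/

section Quotient

universe u

variable {K : Type u} [Field K] {n r : ℕ} (a : Fin r → ℤ)

/-- The quotient of a graded free module by a graded submodule. -/
noncomputable def quotientGrMod (Z : Submodule (Poly K n) (Fin r → Poly K n))
    (hZ : ∀ x ∈ Z, ∀ j, component a j x ∈ Z) : GrMod K n where
  carrier := (Fin r → Poly K n) ⧸ Z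
  piece j := (freePiece K n a j).map Z.mkQ.toAddMonoidHom
  isInternal := by
    classical
    set p : ℤ → AddSubgroup ((Fin r → Poly K n) ⧸ Z) :=
      fun j => (freePiece K n a j).map Z.mkQ.toAddMonoidHom with hp
    constructor
    · let q : ℤ → ((Fin r → Poly K n) ⧸ Z) →+ ((Fin r → Poly K n) ⧸ Z) := fun j =>
        QuotientAddGroup.map Z.toAddSubgroup Z.toAddSubgroup (component a j)
          (fun x hx => hZ x hx j)
      have hq : ∀ i j, ∀ y ∈ p i, q j y = if i = j then y else 0 := by
        rintro i j _ ⟨x, hx, rfl⟩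
        change Z.mkQ (component a j x) = if i = j then Z.mkQ x else 0
        rw [component_of_mem a hx]
        split_ifs <;> simp
      have key : ∀ (y : DirectSum ℤ fun i => p i) (j : ℤ),
          q j (DirectSum.coeAddMonoidHom p y) = y j := by
        intro y j
        induction y using DirectSum.induction_on with
        | zero => simp
        | of i x =>
          rw [DirectSum.coeAddMonoidHom_of, hq i j x x.2]
          split_ifs with h
          · subst h
            simp
          · rw [DirectSum.of_eq_of_ne _ _ _ (Ne.symm h)]
            rfl
        | add y z hy hz => simp [hy, hz]
      intro y z hyz
      refine DFinsupp.ext fun j => Subtype.ext ?_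
      exact (key y j).symm.trans ((congrArg (q j) hyz).trans (key z j))
    · intro y
      obtain ⟨x, rfl⟩ := Z.mkQ_surjective y
      induction x using homogeneous_induction a with
      | hom j x hx =>
        exact ⟨DirectSum.of (fun i => p i) j ⟨Z.mkQ x, x, hx, rfl⟩,
          DirectSum.coeAddMonoidHom_of p j _⟩
      | add x y hx hy =>
        obtain ⟨x', hx'⟩ := hx
        obtain ⟨y', hy'⟩ := hy
        exact ⟨x' + y', by rw [map_add, map_add, hx', hy']⟩
  gradedSMul := by
    constructor
    rintro i j s _ hs ⟨x, hx, rfl⟩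
    exact ⟨s • x, smul_mem_freePiece a hs hx, map_smul Z.mkQ s x⟩

end Quotient

/-! ### Linear strands have vanishing homology in the two lowest degrees. -/

namespace FreeComplex

variable {K : Type*} [Field K] {n : ℕ} (C : FreeComplex K n)

theorem homologyPiece_eq_bot_iff {i : ℕ} {j : ℤ} :
    C.homologyPiece i j = ⊥ ↔ ∀ x ∈ C.cycles i, x ∈ C.piece i j → x ∈ C.boundaries i := by
  rw [AddSubgroup.eq_bot_iff_forall]
  constructor
  · intro h x hx hxj
    have := h _ ⟨⟨x, hx⟩, hxj, rfl⟩
    have hmem : (⟨x, hx⟩ : C.cycles i) ∈ (C.boundaries i).submoduleOf (C.cycles i) := by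
      rw [← Submodule.ker_mkQ ((C.boundaries i).submoduleOf (C.cycles i))]
      exact this
    exact hmem
  · rintro h _ ⟨⟨x, hx⟩, hxj, rfl⟩
    exact (Submodule.Quotient.mk_eq_zero _).mpr (h x hx hxj)

theorem mem_lin_iff {d : ℤ} {i : ℕ} {x : C.X i} :
    x ∈ C.lin d i ↔ ∀ k, C.deg i k ≠ i + d → x k = 0 := by
  constructor
  · intro hx k hk
    have : C.lin d i ≤ LinearMap.ker
        (LinearMap.proj k : (Fin (C.rank i) → Poly K n) →ₗ[Poly K n] Poly K n) := by
      refine Submodule.span_le.mpr ?_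
      rintro _ ⟨l, hl, rfl⟩
      exact Pi.single_eq_of_ne (by rintro rfl; exact hk hl) _
    exact this hx
  · intro h
    rw [pi_eq_sum_univ' x]
    refine Submodule.sum_mem _ fun k _ => ?_
    by_cases hk : C.deg i k = i + d
    · refine Submodule.smul_mem _ _ (Submodule.subset_span ⟨k, hk, ?_⟩)
      ext1 j
      simp [Pi.single_apply, eq_comm]
    · rw [h k hk, zero_smul]
      exact Submodule.zero_mem _

end FreeComplex

universe u

namespace FreeComplex

variable {K : Type u} [Field K] {n : ℕ}

/-- A generator of smaller degree would be sent to zero: in `M` because the piece is zero, in `F_i`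
because its image has entries of degree at most `0` without constant terms. By exactness it would be
a boundary, which minimality forbids for a basis vector. -/
theorem IsMinimalResolution.le_deg {F : FreeComplex K n} {M : GrMod K n} {d : ℤ}
    (hF : F.IsMinimalResolution M) (hM : M.HasInitialDegree d) (i : ℕ) (k : Fin (F.rank i)) :
    i + d ≤ F.deg i k := by
  obtain ⟨ε, hε, -, hexact, hexact', hmin⟩ := hF
  have hsingle : ∀ i (k : Fin (F.rank i)), (Pi.single k 1 : F.X i) ∉
      irrelevantIdeal K n • (⊤ : Submodule (Poly K n) (F.X i)) := by
    intro i k h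
    have := mem_irrelevantIdeal_smul_top_iff.mp h k
    simp at this
  induction i with
  | zero =>
    simp only [Nat.cast_zero, zero_add]
    refine hM.2 fun h => ?_
    have h1 := hε _ _ (single_mem_freePiece (F.deg 0) k)
    rw [h, AddSubgroup.mem_bot] at h1
    exact hsingle 0 k (hmin 0 (hexact ▸ h1))
  | succ i ih =>
    by_contra! hlt
    have h0 : F.diff i (Pi.single k 1) = 0 := by
      have h1 := F.diff_mem i _ _ (single_mem_freePiece (F.deg (i + 1)) k)
      have h2 := mem_irrelevantIdeal_smul_top_iff.mp (hmin i ⟨Pi.single k 1, rfl⟩)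
      ext1 l
      have h3 := ih l
      push_cast at hlt
      rcases lt_or_ge (F.deg (i + 1) k - F.deg i l) 0 with h | h
      · exact eq_zero_of_mem_polyPiece h (h1 l)
      · have h4 := h1 l
        rw [show F.deg (i + 1) k - F.deg i l = 0 by omega] at h4
        rw [eq_C_of_mem_polyPiece_zero h4, h2 l]
        simp
    exact hsingle _ k (hmin (i + 1) (hexact' i ▸ h0))

theorem mem_lin_of_mem_piece {F : FreeComplex K n} {d : ℤ} {i : ℕ}
    (h : ∀ k, i + d ≤ F.deg i k) {x : F.X i} (hx : x ∈ F.piece i (i + d)) : x ∈ F.lin d i := by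
  refine F.mem_lin_iff.mpr fun k hk => eq_zero_of_mem_polyPiece ?_ (hx k)
  have := h k
  omega

theorem homologyPiece_eq_bot_of_isoLin {G F : FreeComplex K n} {M : GrMod K n} {d : ℤ}
    (hM : M.HasInitialDegree d) (hF : F.IsMinimalResolution M) (hG : G.IsoLin F d)
    {i : ℕ} (hi : 0 < i) {j : ℤ} (hj : j = 0 ∨ j = 1) : G.homologyPiece i (i + d + j) = ⊥ := by
  obtain ⟨i, rfl⟩ := Nat.exists_eq_add_of_lt hi
  rw [zero_add]
  have hdeg := hF.le_deg hM
  obtain ⟨φ, hφ, hcomm⟩ := hG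
  obtain ⟨-, -, -, -, hexact, -⟩ := hF
  rw [homologyPiece_eq_bot_iff]
  intro x hx hxj
  have hx0 : G.diff i x = 0 := hx
  have h1 : F.diff i (φ (i + 1) x : F.X (i + 1)) = 0 := by
    rw [← hcomm, hx0, map_zero]
    rfl
  obtain ⟨y, hy⟩ : (φ (i + 1) x : F.X (i + 1)) ∈ LinearMap.range (F.diff (i + 1)) := by
    rw [hexact]
    exact h1
  -- The preimage may be replaced by its component in the degree of the cycle.
  have hy' : F.diff (i + 1) (component (F.deg (i + 2)) (((i + 1 : ℕ) : ℤ) + d + j) y) =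
      φ (i + 1) x := by
    rw [← component_map (F.diff_mem (i + 1)), hy,
      component_of_mem _ ((hφ _ _ _).mp hxj), if_pos rfl]
  have hmem := component_mem (F.deg (i + 2)) (((i + 1 : ℕ) : ℤ) + d + j) y
  generalize component (F.deg (i + 2)) (((i + 1 : ℕ) : ℤ) + d + j) y = z at hy' hmem
  have hz : z ∈ F.lin d (i + 2) := by
    rcases hj with rfl | rfl
    · have : z = 0 := by
        ext1 k
        refine eq_zero_of_mem_polyPiece ?_ (hmem k)
        have := hdeg (i + 2) k
        push_cast at this ⊢
        omega
      rw [this]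
      exact Submodule.zero_mem _
    · refine mem_lin_of_mem_piece (hdeg (i + 2)) ?_
      convert hmem using 2
      push_cast
      ring
  obtain ⟨w, hw⟩ := (φ (i + 2)).surjective ⟨z, hz⟩
  refine ⟨w, (φ (i + 1)).injective (Subtype.ext ?_)⟩
  rw [hcomm, hw, ← hy']

/-! ### Inductive construction of the resolution of `H₀(G)`. -/

/-- A step in the construction of the minimal free resolution of `H₀(G)`: the generators added to
those of `G` in homological degree `i`, and the kernel of the differential. -/
structure ResolutionStage (G : FreeComplex K n) (d : ℤ) (i : ℕ) where
  extraRank : ℕ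
  extraDeg : Fin extraRank → ℤ
  ker : Submodule (Poly K n) (Fin (G.rank i + extraRank) → Poly K n)
  lt_extraDeg : ∀ k, i + d < extraDeg k
  component_mem_ker : ∀ x ∈ ker, ∀ j, component (Fin.append (G.deg i) extraDeg) j x ∈ ker
  constantCoeff_eq_zero : ∀ x ∈ ker, ∀ k, constantCoeff (x k) = 0
  append_diff_mem : ∀ y, (Fin.append (G.diff i y) 0 : Fin _ → Poly K n) ∈ ker
  exists_append_diff : ∀ x ∈ ker,
    x ∈ freePiece K n (Fin.append (G.deg i) extraDeg) (i + 1 + d) →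
    ∃ y, Fin.append (G.diff i y) 0 = x

theorem append_mem_freePiece_iff {r c : ℕ} {a : Fin r → ℤ} {b : Fin c → ℤ} {j : ℤ}
    {x : Fin r → Poly K n} :
    Fin.append x 0 ∈ freePiece K n (Fin.append a b) j ↔ x ∈ freePiece K n a j := by
  constructor
  · intro h k
    simpa using h (Fin.castAdd c k)
  · intro h k
    induction k using Fin.addCases with
    | left k => simpa using h k
    | right k => simp

/-- Extension by zero to additional coordinates. -/
noncomputable def appendZero (r c : ℕ) : (Fin r → Poly K n) →ₗ[Poly K n] (Fin (r + c) → Poly K n) where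
  toFun x := Fin.append x 0
  map_add' x y := by
    ext1 k
    induction k using Fin.addCases <;> simp
  map_smul' p x := by
    ext1 k
    induction k using Fin.addCases <;> simp

theorem constantCoeff_diff {G : FreeComplex K n} {d : ℤ} (hlin : G.IsLinear d) (i : ℕ)
    (x : G.X (i + 1)) (k : Fin (G.rank i)) : constantCoeff (G.diff i x k) = 0 := by
  refine constantCoeff_map_eq_zero (G.diff_mem i) (fun k l => ?_) x k
  rw [hlin, hlin]
  push_cast
  omega

/-- The homological condition on a linear complex to be a linear strand. -/
def AcyclicInLowDegrees (G : FreeComplex K n) (d : ℤ) : Prop :=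
  ∀ i : ℕ, 0 < i → ∀ j : ℤ, j = 0 ∨ j = 1 → G.homologyPiece i (i + d + j) = ⊥

/-- By the case `j = 0`, `x` is a boundary, hence has no constant terms; but in the generator degree
its coordinates are constants. -/
theorem AcyclicInLowDegrees.eq_zero {G : FreeComplex K n} {d : ℤ}
    (hG : G.AcyclicInLowDegrees d) (hlin : G.IsLinear d) {i : ℕ} {x : G.X (i + 1)}
    (hx : x ∈ G.piece (i + 1) (i + 1 + d)) (h : G.diff i x = 0) : x = 0 := by
  have h1 := hG (i + 1) i.succ_pos 0 (Or.inl rfl)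
  rw [homologyPiece_eq_bot_iff] at h1
  obtain ⟨y, rfl⟩ := h1 x h (by convert hx using 2; push_cast; ring)
  ext1 k
  have h2 := hx k
  rw [hlin, Nat.cast_succ, sub_self] at h2
  rw [eq_C_of_mem_polyPiece_zero h2, constantCoeff_diff hlin]
  simp

theorem AcyclicInLowDegrees.exists_diff_eq {G : FreeComplex K n} {d : ℤ}
    (hG : G.AcyclicInLowDegrees d) {i : ℕ} {x : G.X (i + 1)}
    (hx : x ∈ G.piece (i + 1) (i + 2 + d)) (h : G.diff i x = 0) : ∃ y, G.diff (i + 1) y = x := by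
  have h1 := hG (i + 1) i.succ_pos 1 (Or.inr rfl)
  rw [homologyPiece_eq_bot_iff] at h1
  exact h1 x h (by convert hx using 2; push_cast; ring)

namespace ResolutionStage

variable {G : FreeComplex K n} {d : ℤ} {i : ℕ}

/-- The degrees of the generators. -/
abbrev deg (s : ResolutionStage G d i) : Fin (G.rank i + s.extraRank) → ℤ :=
  Fin.append (G.deg i) s.extraDeg

theorem le_deg (hlin : G.IsLinear d) (s : ResolutionStage G d i) (k : Fin _) :
    i + d ≤ s.deg k := by
  induction k using Fin.addCases with
  | left k => simp [hlin i k]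
  | right k => simpa using (s.lt_extraDeg k).le

theorem exists_next (hlin : G.IsLinear d) (hG : G.AcyclicInLowDegrees d)
    (s : ResolutionStage G d i) : ∃ (t : ResolutionStage G d (i + 1))
      (f : (Fin (G.rank (i + 1) + t.extraRank) → Poly K n) →ₗ[Poly K n]
        (Fin (G.rank i + s.extraRank) → Poly K n)),
      (∀ j, ∀ x ∈ freePiece K n t.deg j, f x ∈ freePiece K n s.deg j) ∧
      LinearMap.range f = s.ker ∧ LinearMap.ker f = t.ker ∧
      ∀ x, f (Fin.append x 0) = Fin.append (G.diff i x) 0 := by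
  obtain ⟨c, cd, f, hcd, hfdeg, hrange, happ, hker⟩ := exists_minimal_generators (a := s.deg)
    s.ker s.component_mem_ker (a' := G.deg (i + 1)) (e := i + 1 + d)
    (fun k => by rw [hlin]; push_cast; ring)
    (appendZero (G.rank i) s.extraRank ∘ₗ G.diff i)
    (fun j x hx => append_mem_freePiece_iff.mpr (G.diff_mem i j x hx))
    (by rintro _ ⟨y, rfl⟩; exact s.append_diff_mem y)
    (by
      -- Here `j ≤ i + d`, so coordinates have degree at most `0`, and their constant terms vanish.
      intro j hj x hx hxj
      ext1 k
      have h1 := hxj k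
      have h2 := s.le_deg hlin k
      rcases lt_or_ge (j - s.deg k) 0 with h | h
      · exact eq_zero_of_mem_polyPiece h h1
      · rw [show j - s.deg k = 0 by omega] at h1
        rw [eq_C_of_mem_polyPiece_zero h1, s.constantCoeff_eq_zero x hx]
        simp)
    (fun x hx hxj => s.exists_append_diff x hx hxj)
    (fun x hx h => hG.eq_zero hlin hx (by
      ext1 k
      simpa using (Fin.append_left _ _ k).symm.trans (congrFun h (Fin.castAdd _ k))))
  have happ' : ∀ x, f (Fin.append x 0) = Fin.append (G.diff i x) 0 := happ
  refine ⟨⟨c, cd, LinearMap.ker f, ?_, ?_, hker, ?_, ?_⟩, f, hfdeg, hrange, rfl, happ'⟩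
  · simpa using hcd
  · intro x hx j
    rw [LinearMap.mem_ker, ← component_map hfdeg, LinearMap.mem_ker.mp hx, map_zero]
  · intro y
    rw [LinearMap.mem_ker, happ', show G.diff i (G.diff (i + 1) y) = 0 from
      LinearMap.congr_fun (G.diff_comp_diff i) y]
    exact map_zero (appendZero (K := K) (n := n) (G.rank i) s.extraRank)
  · intro x hx hxj
    -- The new generators have degree at least `i + 2 + d`, so their coordinates in `x` are
    -- constants or zero, and `hker` kills the constants. Thus `x` is a cycle of `G`, and the case
    -- `j = 1` applies.
    have hx' : Fin.append (x ∘ Fin.castAdd c) 0 = x := by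
      ext1 k
      induction k using Fin.addCases with
      | left k => simp
      | right k =>
        have h1 := hxj (Fin.natAdd _ k)
        have h2 := hcd k
        have h3 := hker x hx (Fin.natAdd _ k)
        rw [Fin.append_right] at h1 ⊢
        push_cast at h1
        rcases lt_or_ge ((i : ℤ) + 1 + 1 + d - cd k) 0 with h | h
        · exact (eq_zero_of_mem_polyPiece h h1).symm
        · rw [show (i : ℤ) + 1 + 1 + d - cd k = 0 by omega] at h1
          rw [eq_C_of_mem_polyPiece_zero h1, h3]
          simp
    rw [← hx'] at hx hxj
    rw [append_mem_freePiece_iff] at hxj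
    obtain ⟨y, hy⟩ := hG.exists_diff_eq (i := i) (x := x ∘ Fin.castAdd c)
      (by convert hxj using 2; push_cast; ring) (by
        rw [LinearMap.mem_ker, happ'] at hx
        ext1 k
        simpa using congrFun hx (Fin.castAdd _ k))
    exact ⟨y, by rw [hy, hx']⟩

/-- The first stage, with kernel the image of `G₁`. -/
noncomputable def initial (hlin : G.IsLinear d) : ResolutionStage G d 0 where
  extraRank := 0
  extraDeg := Fin.elim0
  ker := LinearMap.range (appendZero (G.rank 0) 0 ∘ₗ G.diff 0)
  lt_extraDeg k := k.elim0
  component_mem_ker := by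
    rintro _ ⟨x, rfl⟩ j
    exact ⟨_, (component_map (a := G.deg 1) (f := appendZero (G.rank 0) 0 ∘ₗ G.diff 0)
      (fun j x hx => append_mem_freePiece_iff.mpr (G.diff_mem 0 j x hx)) j x).symm⟩
  constantCoeff_eq_zero := by
    rintro _ ⟨x, rfl⟩ k
    induction k using Fin.addCases with
    | left k =>
      refine Eq.trans ?_ (constantCoeff_diff hlin 0 x k)
      exact congrArg constantCoeff (Fin.append_left _ _ k)
    | right k => exact k.elim0
  append_diff_mem y := ⟨y, rfl⟩
  exists_append_diff := by
    rintro _ ⟨x, rfl⟩ -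
    exact ⟨x, rfl⟩

end ResolutionStage

/-! ### Assembling the resolution and identifying its linear strand. -/

/-- If `G_i = 0`, every generator of `G_{i+1}` is a cycle, hence zero by
`AcyclicInLowDegrees.eq_zero`; so `G₀ = 0` would force `G = 0`. -/
theorem rank_zero_ne_zero {G : FreeComplex K n} {d : ℤ} (hlin : G.IsLinear d)
    (hG : G.AcyclicInLowDegrees d) (hne : G.IsNonzero) : G.rank 0 ≠ 0 := by
  intro h0
  obtain ⟨i, hi⟩ := hne
  refine hi ?_
  clear hi
  induction i with
  | zero => exact h0
  | succ i ih =>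
    by_contra hi
    let k : Fin (G.rank (i + 1)) := ⟨0, Nat.pos_of_ne_zero hi⟩
    have h1 := single_mem_freePiece (K := K) (n := n) (G.deg (i + 1)) k
    rw [hlin, Nat.cast_succ] at h1
    have h2 := hG.eq_zero hlin h1 (by
      ext1 l
      exact (Fin.cast ih l).elim0)
    simpa using congrFun h2 k

theorem hasInitialDegree_quotientGrMod {r : ℕ} {a : Fin r → ℤ} {d : ℤ} (hr : r ≠ 0)
    (ha : ∀ k, a k = d) (Z : Submodule (Poly K n) (Fin r → Poly K n))
    (hZ : ∀ x ∈ Z, ∀ j, component a j x ∈ Z) (hZ' : ∀ x ∈ Z, ∀ k, constantCoeff (x k) = 0) :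
    (quotientGrMod a Z hZ).HasInitialDegree d := by
  constructor
  · intro h
    let k : Fin r := ⟨0, Nat.pos_of_ne_zero hr⟩
    have h1 := (AddSubgroup.eq_bot_iff_forall _).mp h (Z.mkQ (Pi.single k 1))
      ⟨_, ha k ▸ single_mem_freePiece a k, rfl⟩
    have h2 := hZ' _ ((Submodule.Quotient.mk_eq_zero Z).mp h1) k
    simp at h2
  · intro j hj
    by_contra! hlt
    refine hj ((AddSubgroup.eq_bot_iff_forall _).mpr ?_)
    rintro _ ⟨x, hx, rfl⟩
    have : x = 0 := by
      ext1 k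
      exact eq_zero_of_mem_polyPiece (by rw [ha]; omega) (hx k)
    rw [this]
    exact map_zero _

theorem exists_resolution {G : FreeComplex K n} {d : ℤ} (hlin : G.IsLinear d)
    (hG : G.AcyclicInLowDegrees d) (hne : G.IsNonzero) :
    ∃ (M : GrMod K n) (F : FreeComplex K n), Module.Finite (Poly K n) M.carrier ∧
      M.HasInitialDegree d ∧ F.IsMinimalResolution M ∧ G.IsoLin F d := by
  choose next f hfdeg hrange hker happ using
    fun i (s : ResolutionStage G d i) => s.exists_next hlin hG
  let s : ∀ i, ResolutionStage G d i :=
    fun i => Nat.rec (ResolutionStage.initial hlin) (fun i s => next i s) i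
  let F : FreeComplex K n :=
    { rank := fun i => G.rank i + (s i).extraRank
      deg := fun i => (s i).deg
      diff := fun i => f i (s i)
      diff_comp_diff := fun i => LinearMap.range_le_ker_iff.mp
        ((hrange (i + 1) (s (i + 1))).trans (hker i (s i)).symm).le
      diff_mem := fun i => hfdeg i (s i) }
  have hFdeg : ∀ k, (s 0).deg k = d := by
    intro k
    induction k using Fin.addCases with
    | left k => exact (Fin.append_left _ _ k).trans (by simp [hlin 0 k])
    | right k => exact Fin.elim0 k
  refine ⟨quotientGrMod (s 0).deg (s 0).ker (s 0).component_mem_ker, F,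
    inferInstanceAs (Module.Finite (Poly K n) (_ ⧸ (s 0).ker)),
    hasInitialDegree_quotientGrMod ?_ hFdeg _ _ (s 0).constantCoeff_eq_zero,
    ⟨(s 0).ker.mkQ, fun j x hx => ⟨x, hx, rfl⟩, Submodule.mkQ_surjective _, ?_, ?_, ?_⟩, ?_⟩
  · have := rank_zero_ne_zero hlin hG hne
    omega
  · exact (hrange 0 (s 0)).trans (Submodule.ker_mkQ _).symm
  · exact fun i => (hrange (i + 1) (s (i + 1))).trans (hker i (s i)).symm
  · intro i x hx
    have hx' : x ∈ (s i).ker := (hrange i (s i)).le hx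
    exact mem_irrelevantIdeal_smul_top_iff.mpr ((s i).constantCoeff_eq_zero x hx')
  -- The extra generators have degree above `i + d`, so the linear summand is exactly the block of
  -- `G_i`.
  · have hmem : ∀ i x, appendZero (G.rank i) (s i).extraRank x ∈ F.lin d i := by
      intro i x
      refine F.mem_lin_iff.mpr fun k => ?_
      induction k using Fin.addCases with
      | left k => exact fun hk => (hk ((Fin.append_left _ _ k).trans (hlin i k))).elim
      | right k => exact fun _ => Fin.append_right _ _ k
    refine ⟨fun i => LinearEquiv.ofBijective
      ((appendZero (G.rank i) (s i).extraRank).codRestrict (F.lin d i) (hmem i)) ⟨?_, ?_⟩,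
      fun i j x => append_mem_freePiece_iff.symm, fun i x => (happ i (s i) x).symm⟩
    · intro x y hxy
      ext1 k
      have := congrFun (congrArg Subtype.val hxy) (Fin.castAdd _ k)
      simpa [appendZero] using this
    · rintro ⟨x, hx⟩
      refine ⟨x ∘ Fin.castAdd _, Subtype.ext (funext fun k => ?_)⟩
      change Fin.append (x ∘ Fin.castAdd _) 0 k = x k
      induction k using Fin.addCases with
      | left k => exact Fin.append_left _ _ k
      | right k =>
        refine (Fin.append_right _ _ k).trans (F.mem_lin_iff.mp hx _ ?_).symm
        have := (s i).lt_extraDeg k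
        change Fin.append _ _ _ ≠ _
        rw [Fin.append_right]
        exact this.ne'

end FreeComplex

end LinearStrands

theorem theorem1p1 (K : Type*) [Field K] (n : ℕ) (d : ℤ)
    (G : LinearStrands.FreeComplex K n) (hfin : G.IsFinite) (hlin : G.IsLinear d)
    (hne : G.IsNonzero) :
    (∃ (M : LinearStrands.GrMod K n) (F : LinearStrands.FreeComplex K n),
        Module.Finite (LinearStrands.Poly K n) M.carrier ∧ M.HasInitialDegree d ∧
        F.IsMinimalResolution M ∧ G.IsoLin F d) ↔
      ∀ i : ℕ, 0 < i → ∀ j : ℤ, j = 0 ∨ j = 1 → G.homologyPiece i (i + d + j) = ⊥ :=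
  ⟨fun ⟨_, _, _, hM, hF, hGF⟩ _ hi _ hj =>
    LinearStrands.FreeComplex.homologyPiece_eq_bot_of_isoLin hM hF hGF hi hj,
    fun h => LinearStrands.FreeComplex.exists_resolution hlin h hne⟩
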